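/- A $k$-strategy network coordination game on the complete graph with player set $[n]$ is given by reals $A_{uv}(i,j)=A_{vu}(j,i)$, for $u\ne v$ in $[n]$ and $i,j\in[k]$ (so there are $\binom n2k^2$ payoff entries). In a strategy profile $\sigma\in[k]^n$ player $u$ receives $\mathrm{payoff}_u(\sigma)=\sum_{v\neq u}A_{uv}(\sigma_u,\sigma_v)$. The profile $\sigma$ is a pure Nash equilibrium if no player can increase her payoff by changing only her own strategy; a better-response move is a change of strategy by a single player that strictly increases her own payoff. An execution of better-response dynamics starts at an arbitrary profile and makes an arbitrary better-response move in each step until a pure Nash equilibrium is reached. **Theorem.** For every $c\in\mathbb N$ there is $C\in\mathbb N$ such that the following holds for all $n,k\in\mathbb N$ and all real $\phi>0$. Let the payoff entries be independent random variables, each supported on $[-1,1]$ and having a density bounded by $\phi$. Then, except on an event of probability at most $1/(nk\phi)^{c}$ over the draw of the payoffs, every execution of better-response dynamics, from every initial profile and with the moves chosen arbitrarily (even adversarially, with knowledge of all the payoffs), reaches a pure Nash equilibrium after at most $(nk\phi)^{Ck}$ steps. (If $nk=0$ the exceptional event has probability $0$.) -/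

import Mathlib

open MeasureTheory ProbabilityTheory

namespace NetCoord

/-- Index set of the payoff vector of a `k`-strategy network coordination game on the game graph
`G`: the unordered pairs `{(u, i), (v, j)}` of (player, strategy) pairs for which `uv` is an edge.
There are `|E| * k ^ 2` of them. The pair `{(u, i), (v, j)}` indexes the payoff `A_{uv}(i, j)`,
which is the same as `A_{vu}(j, i)`. -/
abbrev PayoffEntry {V : Type*} (G : SimpleGraph V) (k : ℕ) : Type _ :=
  {e : Sym2 (V × Fin k) // e.map Prod.fst ∈ G.edgeSet}

/-- The index of the payoff `A_{uv}(i, j)`, for an edge `uv` of `G`. -/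
def PayoffEntry.mk {V : Type*} {G : SimpleGraph V} {k : ℕ} {u v : V} (h : G.Adj u v)
    (i j : Fin k) : PayoffEntry G k :=
  ⟨s((u, i), (v, j)), by simpa using h⟩

section Game

variable {V : Type*} [Fintype V] [DecidableEq V] {G : SimpleGraph V} [DecidableRel G.Adj] {k : ℕ}

/-- `payoff A σ u = ∑_{v : uv ∈ E} A_{uv}(σ_u, σ_v)`, the payoff of player `u` in the strategy
profile `σ`. -/
def payoff (A : PayoffEntry G k → ℝ) (σ : V → Fin k) (u : V) : ℝ :=
  ∑ v : G.neighborSet u, A (PayoffEntry.mk v.2 (σ u) (σ v))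

/-- `σ` is a pure Nash equilibrium: no player gains by a unilateral deviation. -/
def IsPNE (A : PayoffEntry G k → ℝ) (σ : V → Fin k) : Prop :=
  ∀ (u : V) (i : Fin k), payoff A (Function.update σ u i) u ≤ payoff A σ u

/-- `σ'` arises from `σ` by one better-response move: a single player `u` changes strategy and
strictly improves her own payoff. -/
def IsBetterResponseMove (A : PayoffEntry G k → ℝ) (σ σ' : V → Fin k) : Prop :=
  ∃ (u : V) (i : Fin k), σ' = Function.update σ u i ∧ payoff A σ u < payoff A σ' u

/-- `σ 0, σ 1, …` is an execution of the better-response algorithm on the game `A`, where `σ t` is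
the profile after `t` steps: as long as the current profile is not a pure Nash equilibrium, some
better-response move is made (no restriction is placed on which one); at a pure Nash equilibrium
the algorithm has stopped, and the profile stays the same from then on. -/
def IsBRExecution (A : PayoffEntry G k → ℝ) (σ : ℕ → V → Fin k) : Prop :=
  ∀ t : ℕ, (¬ IsPNE A (σ t) ∧ IsBetterResponseMove A (σ t) (σ (t + 1))) ∨
    (IsPNE A (σ t) ∧ σ (t + 1) = σ t)

end Game

/-- The random payoff vector `A` is a smoothed instance with density bound `φ` on the game graph
`G` with `k` strategies: its entries are independent, supported on `[-1, 1]`, and each has a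
density (with respect to Lebesgue measure) bounded by `φ`. -/
structure IsSmoothedInstance {V : Type*} (G : SimpleGraph V) (k : ℕ) (φ : ℝ)
    {Ω : Type*} [MeasurableSpace Ω] (μ : Measure Ω) (A : PayoffEntry G k → Ω → ℝ) : Prop where
  indep : iIndepFun A μ
  supported : ∀ e, ∀ᵐ ω ∂μ, A e ω ∈ Set.Icc (-1 : ℝ) 1
  hasPDF : ∀ e, HasPDF (A e) μ volume
  pdf_le : ∀ e, ∀ᵐ x ∂(volume : Measure ℝ), pdf (A e) μ volume x ≤ ENNReal.ofReal φ

end NetCoord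

/-!
Half the sum of all payoffs is a potential: a better-response move that gains `x` raises it by `x`.
Since it takes values in `[-n² / 2, n² / 2]`, it suffices to show that with high probability each
run of `2 n k` consecutive moves contains one that gains more than some `ε = (n k φ) ^ (-O(k))`.

Call a move fresh if the moving player has not held the new strategy before. In a run of `2 n k`
moves at most half are fresh, so the run contains a critical block: a shortest block with at most
half of its moves fresh. Whenever a player returns to a strategy, the total gain of her moves since
the last visit is a linear form in the payoffs in which the players who do not move cancel. If all
moves gain at most `ε`, all these forms take values in an interval of length `O(n k ε)`. The point
is that a critical block of length `ℓ` yields `Ω(ℓ / k)` such forms that are triangular with pivot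
coefficients of absolute value at least one (`IsCritical.measure_slowLoopEvent_le`), so that the
block is slow with probability `(O(n k φ ε)) ^ Ω(ℓ / k)` (`measure_pi_forall_abs_le_le`).

The triangular forms arise in two ways. Let a player be cyclic if she returns to some strategy
within the block. If there are many cyclic players, one closed walk is taken for each of them, and
pivots are found by passing to an independent set in a graph of out-degree one
(`exists_subset_card_le_three_mul`). Otherwise many moves are made by acyclic players. These cut the
block into epochs of moves by cyclic players only; by minimality of the block at least half of the
moves in each epoch are fresh within the epoch, hence many moves return to a strategy visited in an
earlier epoch (`IsCritical.le_recurrent_add_cyclic`). Between the two epochs an acyclic player has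
moved to a strategy never held before, and in the complete graph this player shares a payoff entry
with the returning player, which serves as the pivot (`IsMovePath.exists_pivot`).

As the players who do not move cancel, a block only has to be specified by its moves and the initial
strategies of the moving players. There are at most `(n k²) ^ ℓ` choices, and the union bound over
them succeeds for `ε = (n k φ) ^ (-O(k))` (`measure_slowEvent_le`).
-/

namespace NetCoord

/-! ### Small values of triangular systems of linear forms -/

/-- If finitely many linear forms in independent coordinates of density at most `φ` have
coefficients of absolute value at least one at chosen pivot coordinates, and each form vanishes at
the pivots of all later forms, then the forms are simultaneously at most `η` in absolute value with
probability at most `(2 φ η) ^ s`, where `s` is their number. The last form is peeled off by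
integrating over its own pivot coordinate, on which the earlier forms do not depend. -/
theorem measure_pi_forall_abs_le_le {ι E : Type*} [LinearOrder ι] [Fintype E] [DecidableEq E]
    (ν : E → Measure ℝ) [∀ e, IsProbabilityMeasure (ν e)] {φ : ENNReal}
    (hν : ∀ e, ν e ≤ φ • volume) (L : ι → (E → ℝ) →ₗ[ℝ] ℝ) (p : ι → E) (η : ℝ) (s : Finset ι)
    (hpivot : ∀ i ∈ s, 1 ≤ |L i (Pi.single (p i) 1)|)
    (hzero : ∀ i ∈ s, ∀ j ∈ s, j < i → L j (Pi.single (p i) 1) = 0) :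
    Measure.pi ν {x | ∀ i ∈ s, |L i x| ≤ η} ≤ (φ * ENNReal.ofReal (2 * η)) ^ s.card := by
  have hmeas : ∀ s : Finset ι, MeasurableSet {x | ∀ i ∈ s, |L i x| ≤ η} := by
    intro s
    have : {x | ∀ i ∈ s, |L i x| ≤ η} = ⋂ i ∈ s, {x | |L i x| ≤ η} := by ext; simp
    rw [this]
    refine Finset.measurableSet_biInter _ fun i _ => ?_
    exact measurableSet_le
      ((LinearMap.continuous_of_finiteDimensional (L i)).measurable.abs) measurable_const
  induction s using Finset.induction_on_max with
  | empty => simp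
  | insert a s ha ih =>
    have has : a ∉ s := fun h => lt_irrefl _ (ha a h)
    have ih' := ih (fun i hi => hpivot i (Finset.mem_insert_of_mem hi))
      (fun i hi j hj => hzero i (Finset.mem_insert_of_mem hi) j (Finset.mem_insert_of_mem hj))
    set S : Set (E → ℝ) := {x | ∀ i ∈ s, |L i x| ≤ η} with hS
    set S' : Set (E → ℝ) := {x | ∀ i ∈ insert a s, |L i x| ≤ η} with hS'
    set c := φ * ENNReal.ofReal (2 * η)
    have hupd : ∀ (i : ι) (x : E → ℝ) (y : ℝ), L i (Function.update x (p a) y) =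
        L i x + (y - x (p a)) * L i (Pi.single (p a) 1) := by
      intro i x y
      have : Function.update x (p a) y = x + (y - x (p a)) • Pi.single (p a) (1 : ℝ) := by
        ext e
        by_cases he : e = p a
        · subst he; simp
        · simp [he]
      rw [this, map_add, map_smul, smul_eq_mul]
    have key : ∫⁻ x, S'.indicator 1 x ∂(Measure.pi ν) ≤
        ∫⁻ x, c * S.indicator 1 x ∂(Measure.pi ν) := by
      refine lintegral_le_of_lmarginal_le {p a}
        (measurable_one.indicator (hmeas _))
        ((measurable_one.indicator (hmeas _)).const_mul _) ?_
      intro x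
      rw [lmarginal_singleton, lmarginal_singleton]
      have hSx : ∀ y, Function.update x (p a) y ∈ S ↔ x ∈ S := by
        intro y
        simp only [hS, Set.mem_ofPred_eq]
        refine forall₂_congr fun i hi => ?_
        rw [hupd, hzero a (Finset.mem_insert_self _ _) i (Finset.mem_insert_of_mem hi) (ha i hi)]
        simp
      by_cases hx : x ∈ S
      · have h2 : ∀ y, S.indicator (1 : (E → ℝ) → ENNReal) (Function.update x (p a) y) = 1 := by
          intro y; rw [Set.indicator_of_mem ((hSx y).2 hx)]; rfl
        simp only [h2, mul_one, lintegral_const, measure_univ]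
        set b := L a (Pi.single (p a) 1) with hb
        have hb1 : 1 ≤ |b| := hpivot a (Finset.mem_insert_self _ _)
        have hb0 : b ≠ 0 := by intro h; rw [h] at hb1; norm_num at hb1
        set z := x (p a) - L a x / b with hz
        calc ∫⁻ y, S'.indicator 1 (Function.update x (p a) y) ∂(ν (p a))
            ≤ ∫⁻ y, (Metric.closedBall z η).indicator 1 y ∂(ν (p a)) := by
              refine lintegral_mono fun y => ?_
              by_cases hy : Function.update x (p a) y ∈ S'
              · rw [Set.indicator_of_mem hy, Set.indicator_of_mem]
                · rfl
                · have h3 : |L a (Function.update x (p a) y)| ≤ η :=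
                    hy a (Finset.mem_insert_self _ _)
                  rw [hupd] at h3
                  rw [Metric.mem_closedBall, Real.dist_eq]
                  have h4 : L a x + (y - x (p a)) * b = (y - z) * b := by
                    rw [hz]; field_simp; ring
                  rw [h4, abs_mul] at h3
                  nlinarith [abs_nonneg (y - z)]
              · rw [Set.indicator_of_notMem hy]; exact zero_le
          _ = ν (p a) (Metric.closedBall z η) := by
              rw [lintegral_indicator_one Metric.isClosed_closedBall.measurableSet]
          _ ≤ c := by
              refine (hν (p a) _).trans ?_
              rw [Measure.smul_apply, Real.volume_closedBall, smul_eq_mul]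
      · have h2 : ∀ y, S'.indicator (1 : (E → ℝ) → ENNReal) (Function.update x (p a) y) = 0 := by
          intro y
          refine Set.indicator_of_notMem (fun h => hx ((hSx y).1 ?_)) _
          exact fun i hi => h i (Finset.mem_insert_of_mem hi)
        simp [h2]
    rw [lintegral_indicator_one (hmeas _),
      lintegral_const_mul _ (measurable_one.indicator (hmeas _)),
      lintegral_indicator_one (hmeas _)] at key
    rw [Finset.card_insert_of_notMem has, pow_succ']
    exact key.trans (by gcongr)

/-! ### Fresh moves and critical paths -/

section Path

variable {V : Type*} {k : ℕ}

/-- During the times `t < ℓ`, the player `v t` (and nobody else) changes strategy between the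
profiles `σ t` and `σ (t + 1)`. Values of `σ` and `v` at later times are irrelevant. -/
structure IsMovePath (ℓ : ℕ) (σ : ℕ → V → Fin k) (v : ℕ → V) : Prop where
  off : ∀ t < ℓ, ∀ u, u ≠ v t → σ (t + 1) u = σ t u
  ne : ∀ t < ℓ, σ (t + 1) (v t) ≠ σ t (v t)

/-- The strategy to which `v t` moves at time `t` differs from every strategy that this player has
held from time `x` on, the one held at time `x` included. -/
def IsFresh (σ : ℕ → V → Fin k) (v : ℕ → V) (x t : ℕ) : Prop :=
  ∀ r, x ≤ r → r ≤ t → σ r (v t) ≠ σ (t + 1) (v t)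

/-- The last time `r ≤ t` at which `v t` holds the strategy to which she moves at time `t`. It is
meaningful when the move at time `t` is not fresh since time `0`; the value is `0` if there is no
such `r`. -/
def lastVisit (σ : ℕ → V → Fin k) (v : ℕ → V) (t : ℕ) : ℕ :=
  Nat.findGreatest (fun r => σ r (v t) = σ (t + 1) (v t)) t

theorem lastVisit_le (σ : ℕ → V → Fin k) (v : ℕ → V) (t : ℕ) : lastVisit σ v t ≤ t :=
  Nat.findGreatest_le t

theorem apply_lastVisit {σ : ℕ → V → Fin k} {v : ℕ → V} {t : ℕ} (h : ¬ IsFresh σ v 0 t) :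
    σ (lastVisit σ v t) (v t) = σ (t + 1) (v t) := by
  simp only [IsFresh, not_forall, not_not] at h
  obtain ⟨r, -, hr, h⟩ := h
  exact Nat.findGreatest_spec (P := fun r => σ r (v t) = σ (t + 1) (v t)) hr h

open Classical in
/-- The times in `[x, y)` of the moves that are fresh since time `x`. -/
noncomputable def freshTimes (σ : ℕ → V → Fin k) (v : ℕ → V) (x y : ℕ) : Finset ℕ :=
  (Finset.Ico x y).filter (IsFresh σ v x)

theorem mem_freshTimes {σ : ℕ → V → Fin k} {v : ℕ → V} {x y t : ℕ} :
    t ∈ freshTimes σ v x y ↔ (x ≤ t ∧ t < y) ∧ IsFresh σ v x t := by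
  classical
  simp [freshTimes]

theorem IsFresh.eq_of_target_eq {σ : ℕ → V → Fin k} {v : ℕ → V} {x s t : ℕ} (hs : IsFresh σ v x s)
    (ht : IsFresh σ v x t) (hxs : x ≤ s) (hxt : x ≤ t) (hv : v s = v t)
    (hσ : σ (s + 1) (v s) = σ (t + 1) (v t)) : s = t := by
  rcases lt_trichotomy s t with h | h | h
  · exact absurd (hv ▸ hσ) (ht (s + 1) (by omega) h)
  · exact h
  · exact absurd (by rw [← hv] at hσ; rw [hv] at hσ ⊢; exact hσ.symm) (hs (t + 1) (by omega) h)

theorem card_freshTimes_le [Fintype V] (σ : ℕ → V → Fin k) (v : ℕ → V) (x y : ℕ) :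
    (freshTimes σ v x y).card ≤ Fintype.card V * k := by
  have : (freshTimes σ v x y).card ≤ (Finset.univ : Finset (V × Fin k)).card := by
    refine Finset.card_le_card_of_injOn (fun t => (v t, σ (t + 1) (v t))) (by simp) ?_
    intro s hs t ht hst
    rw [Finset.mem_coe, mem_freshTimes] at hs ht
    simp only [Prod.mk.injEq] at hst
    exact hs.2.eq_of_target_eq ht.2 hs.1.1 ht.1.1 hst.1 hst.2
  simpa using this

theorem card_freshTimes_shift (σ : ℕ → V → Fin k) (v : ℕ → V) (s x y : ℕ) :
    (freshTimes (fun t => σ (s + t)) (fun t => v (s + t)) x y).card =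
      (freshTimes σ v (s + x) (s + y)).card := by
  refine Finset.card_nbij' (fun t => s + t) (fun t => t - s) ?_ ?_ ?_ ?_
  · intro t ht
    simp only [Finset.mem_coe, mem_freshTimes] at ht ⊢
    refine ⟨by omega, fun r h1 h2 => ?_⟩
    have := ht.2 (r - s) (by omega) (by omega)
    beta_reduce at this
    rwa [show s + (r - s) = r by omega, ← add_assoc] at this
  · intro t ht
    simp only [Finset.mem_coe, mem_freshTimes] at ht ⊢
    refine ⟨by omega, fun r h1 h2 => ?_⟩
    have := ht.2 (s + r) (by omega) (by omega)
    rwa [← show s + (t - s) = t by omega, add_assoc] at this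
  · intro t _; simp
  · intro t ht
    simp only [Finset.mem_coe, mem_freshTimes] at ht
    simp only; omega

/-- A nonempty move path at most half of whose moves are fresh since time `0`, while in each block
`[x, y)` at least half of the moves are fresh since time `x`. In particular `ℓ` is exactly twice the
number of fresh moves. -/
structure IsCritical (ℓ : ℕ) (σ : ℕ → V → Fin k) (v : ℕ → V) : Prop extends IsMovePath ℓ σ v where
  pos : 0 < ℓ
  whole : 2 * (freshTimes σ v 0 ℓ).card ≤ ℓ
  sub : ∀ x y, y ≤ ℓ → y ≤ x + 2 * (freshTimes σ v x y).card

/-- Fresh moves go to distinct (player, strategy) pairs, so a path of length at least twice the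
number of pairs has at most half of its moves fresh. A block of minimal length with this property is
critical. -/
theorem IsMovePath.exists_isCritical [Fintype V] {L : ℕ} {σ : ℕ → V → Fin k} {v : ℕ → V}
    (h : IsMovePath L σ v) (hL : 2 * (Fintype.card V * k) ≤ L) (hpos : 0 < L) :
    ∃ s ℓ, s + ℓ ≤ L ∧ IsCritical ℓ (fun t => σ (s + t)) (fun t => v (s + t)) := by
  classical
  -- `P m`: some block of length `m` has at most half of its moves fresh.
  let P : ℕ → Prop := fun m => 0 < m ∧ ∃ s, s + m ≤ L ∧ 2 * (freshTimes σ v s (s + m)).card ≤ m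
  have hP : ∃ m, P m :=
    ⟨L, hpos, 0, by omega, by have := card_freshTimes_le σ v 0 (0 + L); omega⟩
  obtain ⟨hm0, s, hsm, hfresh⟩ := Nat.find_spec hP
  have hmin : ∀ m, m < Nat.find hP → ¬ P m := fun m hm => Nat.find_min hP hm
  set ℓ := Nat.find hP
  have hsmall : ∀ m, 0 < m → m < ℓ → ∀ s, s + m ≤ L → m < 2 * (freshTimes σ v s (s + m)).card := by
    intro m hm hml s hs
    by_contra hcon
    exact hmin m hml ⟨hm, s, hs, by omega⟩
  refine ⟨s, ℓ, hsm, ⟨⟨?_, ?_⟩, hm0, ?_, ?_⟩⟩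
  · intro t ht u hu
    exact h.off (s + t) (by omega) u hu
  · intro t ht
    exact h.ne (s + t) (by omega)
  · rw [card_freshTimes_shift]; simpa using hfresh
  · intro x y hy
    rw [card_freshTimes_shift]
    rcases le_or_gt y x with hyx | hxy
    · omega
    by_cases hlt : y - x < ℓ
    · have := hsmall (y - x) (by omega) hlt (s + x) (by omega)
      rw [show s + x + (y - x) = s + y by omega] at this
      omega
    · -- For the whole block, the bound for the block without its last move is rounded up.
      obtain ⟨rfl, rfl⟩ : x = 0 ∧ y = ℓ := by omega
      rw [Nat.add_zero]
      have hmono : (freshTimes σ v s (s + (ℓ - 1))).card ≤ (freshTimes σ v s (s + ℓ)).card := by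
        refine Finset.card_le_card fun t ht => ?_
        rw [mem_freshTimes] at ht ⊢
        exact ⟨by omega, ht.2⟩
      rcases Nat.lt_or_ge 1 ℓ with h1 | h1
      · have := hsmall (ℓ - 1) (by omega) (by omega) s (by omega)
        omega
      · have : 0 < (freshTimes σ v s (s + ℓ)).card := by
          refine Finset.card_pos.2 ⟨s, ?_⟩
          rw [mem_freshTimes]
          refine ⟨by omega, fun r h2 h3 => ?_⟩
          obtain rfl : r = s := by omega
          exact (h.ne r (by omega)).symm
        omega

open Classical in
/-- The times at which `P` holds fall into epochs, the maximal runs of consecutive such times. For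
`t` in an epoch, `epochStart P t` is the first time of this epoch. -/
noncomputable def epochStart (P : ℕ → Prop) (t : ℕ) : ℕ :=
  Nat.findGreatest (fun r => r = 0 ∨ ¬ P (r - 1)) t

theorem epochStart_le (P : ℕ → Prop) (t : ℕ) : epochStart P t ≤ t := by
  classical
  exact Nat.findGreatest_le t

theorem epochStart_spec (P : ℕ → Prop) (t : ℕ) :
    epochStart P t = 0 ∨ ¬ P (epochStart P t - 1) := by
  classical
  exact Nat.findGreatest_spec (P := fun r => r = 0 ∨ ¬ P (r - 1)) (Nat.zero_le t) (Or.inl rfl)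

theorem of_epochStart_le {P : ℕ → Prop} {t r : ℕ} (h1 : epochStart P t ≤ r) (h2 : r < t) : P r := by
  classical
  unfold epochStart at h1
  have := Nat.findGreatest_is_greatest (Nat.lt_succ_of_le h1) h2
  simpa using this

theorem epochStart_eq {P : ℕ → Prop} {s t : ℕ} (h1 : epochStart P t ≤ s) (h2 : s ≤ t) :
    epochStart P s = epochStart P t := by
  refine le_antisymm ?_ ?_
  · by_contra hlt
    rcases epochStart_spec P s with h | h
    · omega
    · exact h (of_epochStart_le (t := t) (by omega) (by have := epochStart_le P s; omega))
  · by_contra hlt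
    rcases epochStart_spec P t with h | h
    · omega
    · exact h (of_epochStart_le (t := s) (by omega) (by omega))

open Classical in
/-- If in each interval `[x, y)` at least half of the times are good relative to the start `x`, then
at least half of the times with property `P` are good relative to the start of their epoch. -/
theorem card_filter_le_two_mul_card_filter_epochStart (P : ℕ → Prop) (F : ℕ → ℕ → Prop) (ℓ : ℕ)
    (h : ∀ x y, y ≤ ℓ → y ≤ x + 2 * ((Finset.Ico x y).filter (F x)).card) :
    ∀ y ≤ ℓ, ((Finset.range y).filter P).card ≤
      2 * ((Finset.range y).filter (fun t => P t ∧ F (epochStart P t) t)).card := by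
  intro y
  induction y using Nat.strong_induction_on with
  | _ y ih =>
    intro hy
    obtain _ | z := y
    · simp
    by_cases hz : P z
    · have hx := epochStart_le P z
      set x := epochStart P z with hxdef
      have ih' := ih x (by omega) (by omega)
      have hr : Finset.range (z + 1) = Finset.range x ∪ Finset.Ico x (z + 1) := by
        ext t; simp; omega
      have hd : Disjoint (Finset.range x) (Finset.Ico x (z + 1)) := by
        rw [Finset.disjoint_left]; intro t; simp; omega
      have hF : (Finset.Ico x (z + 1)).filter (fun t => P t ∧ F (epochStart P t) t) =
          (Finset.Ico x (z + 1)).filter (F x) := by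
        refine Finset.filter_congr fun t ht => ?_
        rw [Finset.mem_Ico] at ht
        rw [epochStart_eq ht.1 (by omega)]
        have : P t := by
          rcases Nat.lt_or_ge t z with h1 | h1
          · exact of_epochStart_le ht.1 h1
          · rwa [show t = z by omega]
        simp [this, hxdef]
      have hsub := h x (z + 1) hy
      rw [hr, Finset.filter_union, Finset.filter_union,
        Finset.card_union_of_disjoint (Finset.disjoint_filter_filter hd),
        Finset.card_union_of_disjoint (Finset.disjoint_filter_filter hd), hF]
      have : ((Finset.Ico x (z + 1)).filter P).card ≤ z + 1 - x := by
        simpa using Finset.card_filter_le (Finset.Ico x (z + 1)) P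
      omega
    · have ih' := ih z (by omega) (by omega)
      rw [Finset.range_add_one, Finset.filter_insert, Finset.filter_insert, if_neg hz,
        if_neg (fun hh => hz hh.1)]
      exact ih'

/-- The player `u` returns, before time `ℓ`, to a strategy she held before. The players that are not
cyclic hold every strategy during one interval of time only. -/
def IsCyclic (ℓ : ℕ) (σ : ℕ → V → Fin k) (v : ℕ → V) (u : V) : Prop :=
  ∃ t < ℓ, v t = u ∧ ¬ IsFresh σ v 0 t

open Classical in
/-- The times of the moves of cyclic players that are fresh since the start of the current epoch of
moves by cyclic players, but not fresh since time `0`. -/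
noncomputable def recurrentTimes (ℓ : ℕ) (σ : ℕ → V → Fin k) (v : ℕ → V) : Finset ℕ :=
  (Finset.range ℓ).filter fun t => IsCyclic ℓ σ v (v t) ∧
    IsFresh σ v (epochStart (fun r => IsCyclic ℓ σ v (v r)) t) t ∧ ¬ IsFresh σ v 0 t

open Classical in
/-- The finite set of cyclic players. -/
noncomputable def cyclicPlayers [Fintype V] (ℓ : ℕ) (σ : ℕ → V → Fin k) (v : ℕ → V) : Finset V :=
  Finset.univ.filter (IsCyclic ℓ σ v)

/-- On a critical path, either there are many recurrent moves, or there are many cyclic players.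
With `a` moves by acyclic players and `b` fresh moves by cyclic players, `ℓ = 2 (a + b)`; at least
half of the `ℓ - a` moves by cyclic players are fresh in their epoch, and removing the `b` fresh
ones leaves at least `a / 2` recurrent moves, while `b` is at most `k` times the number of cyclic
players. -/
theorem IsCritical.le_recurrent_add_cyclic [Fintype V] {ℓ : ℕ} {σ : ℕ → V → Fin k} {v : ℕ → V}
    (h : IsCritical ℓ σ v) :
    ℓ ≤ 4 * (recurrentTimes ℓ σ v).card + 2 * (k * (cyclicPlayers ℓ σ v).card) := by
  classical
  set Cy : ℕ → Prop := fun t => IsCyclic ℓ σ v (v t) with hCy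
  have hcount : ((Finset.range ℓ).filter Cy).card ≤
      2 * ((Finset.range ℓ).filter fun t => Cy t ∧ IsFresh σ v (epochStart Cy t) t).card :=
    card_filter_le_two_mul_card_filter_epochStart Cy (IsFresh σ v) ℓ
      (fun x y hy => by simpa only [freshTimes] using h.sub x y hy) ℓ le_rfl
  have hsplit : (freshTimes σ v 0 ℓ).card = ((Finset.range ℓ).filter fun t => ¬ Cy t).card +
      ((Finset.range ℓ).filter fun t => Cy t ∧ IsFresh σ v 0 t).card := by
    rw [← Finset.card_union_of_disjoint]
    · congr 1
      ext t
      simp only [mem_freshTimes, Finset.mem_union, Finset.mem_filter, Finset.mem_range]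
      constructor
      · rintro ⟨⟨-, h1⟩, h2⟩
        by_cases h3 : Cy t
        · exact Or.inr ⟨h1, h3, h2⟩
        · exact Or.inl ⟨h1, h3⟩
      · rintro (⟨h1, h2⟩ | ⟨h1, -, h2⟩)
        · refine ⟨⟨Nat.zero_le _, h1⟩, ?_⟩
          by_contra h3
          exact h2 ⟨t, h1, rfl, h3⟩
        · exact ⟨⟨Nat.zero_le _, h1⟩, h2⟩
    · rw [Finset.disjoint_left]
      intro t h1 h2
      simp only [Finset.mem_filter] at h1 h2
      exact h1.2 h2.2.1
  have hall : ((Finset.range ℓ).filter Cy).card + ((Finset.range ℓ).filter fun t => ¬ Cy t).card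
      = ℓ := by
    rw [Finset.card_filter_add_card_filter_not, Finset.card_range]
  have hrec : ((Finset.range ℓ).filter fun t => Cy t ∧ IsFresh σ v (epochStart Cy t) t).card ≤
      (recurrentTimes ℓ σ v).card +
        ((Finset.range ℓ).filter fun t => Cy t ∧ IsFresh σ v 0 t).card := by
    refine (Finset.card_le_card ?_).trans (Finset.card_union_le _ _)
    intro t
    simp only [recurrentTimes, Finset.mem_union, Finset.mem_filter, Finset.mem_range]
    tauto
  have hcyc : ((Finset.range ℓ).filter fun t => Cy t ∧ IsFresh σ v 0 t).card ≤
      k * (cyclicPlayers ℓ σ v).card := by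
    have : ((Finset.range ℓ).filter fun t => Cy t ∧ IsFresh σ v 0 t).card ≤
        (cyclicPlayers ℓ σ v ×ˢ (Finset.univ : Finset (Fin k))).card := by
      refine Finset.card_le_card_of_injOn (fun t => (v t, σ (t + 1) (v t))) ?_ ?_
      · intro t ht
        simp only [Finset.coe_filter, Set.mem_ofPred_eq, hCy] at ht
        simp [cyclicPlayers, ht.2.1]
      · intro s hs t ht hst
        simp only [Finset.coe_filter, Set.mem_ofPred_eq] at hs ht
        simp only [Prod.mk.injEq] at hst
        exact hs.2.2.eq_of_target_eq ht.2.2 (Nat.zero_le _) (Nat.zero_le _) hst.1 hst.2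
    rw [Finset.card_product, Finset.card_univ, Fintype.card_fin, mul_comm] at this
    exact this
  have h1 := h.whole
  have h2 := h.sub 0 ℓ le_rfl
  omega

/-- The graph of a self-map without fixed points on `C` contains an independent set of at least a
third of the vertices: repeatedly pick a vertex with at most one preimage. -/
theorem exists_subset_card_le_three_mul [DecidableEq V] (f : V → V) (C : Finset V)
    (hf : ∀ v ∈ C, f v ≠ v) :
    ∃ W ⊆ C, C.card ≤ 3 * W.card ∧ ∀ v ∈ W, f v ∉ W := by
  induction C using Finset.strongInduction with
  | H C ih =>
    rcases C.eq_empty_or_nonempty with rfl | hC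
    · exact ⟨∅, by simp⟩
    obtain ⟨v, hv, hfib⟩ : ∃ v ∈ C, (C.filter fun w => f w = v).card ≤ 1 := by
      by_contra! hcon
      have h1 : ∑ v ∈ C, (C.filter fun w => f w = v).card ≤ C.card := by
        rw [← Finset.card_biUnion]
        · exact Finset.card_le_card (Finset.biUnion_subset.2 fun v _ => Finset.filter_subset _ _)
        · intro v _ v' _ hvv
          rw [Function.onFun, Finset.disjoint_left]
          intro w hw hw'
          exact hvv ((Finset.mem_filter.1 hw).2.symm.trans (Finset.mem_filter.1 hw').2)
      have h2 : ∑ v ∈ C, 2 ≤ ∑ v ∈ C, (C.filter fun w => f w = v).card :=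
        Finset.sum_le_sum fun v hv => hcon v hv
      have h3 := hC.card_pos
      simp only [Finset.sum_const, smul_eq_mul] at h2
      omega
    set R : Finset V := insert v (insert (f v) (C.filter fun w => f w = v)) with hR
    have hRcard : R.card ≤ 3 := by
      refine (Finset.card_insert_le _ _).trans ?_
      have := Finset.card_insert_le (f v) (C.filter fun w => f w = v)
      omega
    obtain ⟨W, hWC, hcard, hW⟩ := ih (C \ R)
      (Finset.ssubset_iff_subset_ne.2 ⟨Finset.sdiff_subset, fun h => by
        have : v ∈ C \ R := by rwa [h]
        simp [hR] at this⟩)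
      (fun w hw => hf w (Finset.mem_sdiff.1 hw).1)
    have hvW : v ∉ W := fun h => by
      have := hWC h
      simp [hR] at this
    refine ⟨insert v W, ?_, ?_, ?_⟩
    · exact Finset.insert_subset hv (hWC.trans Finset.sdiff_subset)
    · rw [Finset.card_insert_of_notMem hvW]
      have := Finset.le_card_sdiff R C
      omega
    · intro w hw
      rw [Finset.mem_insert, not_or]
      rcases Finset.mem_insert.1 hw with rfl | hw
      · refine ⟨hf w hv, fun h => ?_⟩
        have := hWC h
        simp [hR] at this
      · refine ⟨fun h => ?_, hW w hw⟩
        have := Finset.mem_sdiff.1 (hWC hw)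
        exact this.2 (by simp [hR, h, this.1])

end Path

/-! ### Gains along closed walks as linear forms -/

section Loop

variable {V : Type*} [DecidableEq V] {k : ℕ}

/-- The payoff `A_{vu}(a, b)` as a linear form in the payoff vector, with the value `0` for `v = u`,
where there is no payoff entry. -/
def pairPayoff (v u : V) (a b : Fin k) : (PayoffEntry (⊤ : SimpleGraph V) k → ℝ) →ₗ[ℝ] ℝ :=
  if h : v ≠ u then LinearMap.proj (PayoffEntry.mk (G := ⊤) h a b) else 0

theorem pairPayoff_of_ne {v u : V} (h : v ≠ u) (a b : Fin k)
    (A : PayoffEntry (⊤ : SimpleGraph V) k → ℝ) :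
    pairPayoff v u a b A = A (PayoffEntry.mk (G := ⊤) h a b) := by
  simp [pairPayoff, h]

theorem pairPayoff_self (v : V) (a b : Fin k) : pairPayoff v v a b = 0 := by
  simp [pairPayoff]

theorem pairPayoff_comm (v u : V) (a b : Fin k) : pairPayoff v u a b = pairPayoff u v b a := by
  by_cases h : v = u
  · subst h; simp [pairPayoff_self]
  · ext1 A
    have : PayoffEntry.mk (G := (⊤ : SimpleGraph V)) h a b =
        PayoffEntry.mk (G := ⊤) (Ne.symm h) b a := Subtype.ext Sym2.eq_swap
    simp [pairPayoff_of_ne h, pairPayoff_of_ne (Ne.symm h), this]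

theorem payoff_eq_sum_pairPayoff [Fintype V] (A : PayoffEntry (⊤ : SimpleGraph V) k → ℝ)
    (σ : V → Fin k) (v : V) : payoff A σ v = ∑ u, pairPayoff v u (σ v) (σ u) A := by
  classical
  rw [payoff, ← Finset.sum_filter_add_sum_filter_not Finset.univ (fun u => v ≠ u)
    (fun u => pairPayoff v u (σ v) (σ u) A)]
  rw [Finset.sum_eq_zero (s := Finset.univ.filter fun u => ¬ v ≠ u), add_zero]
  · refine Finset.sum_bij (fun u _ => u.1) (fun u _ => ?_) (fun u _ u' _ h => Subtype.ext h)
      (fun u hu => ?_) (fun u _ => ?_)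
    · simpa [eq_comm] using u.2
    · exact ⟨⟨u, by simpa [eq_comm] using hu⟩, Finset.mem_univ _, rfl⟩
    · rw [pairPayoff_of_ne (by simpa [eq_comm] using u.2)]
  · intro u hu
    have : v = u := by simpa using hu
    subst this
    simp [pairPayoff_self]

theorem pairPayoff_single [DecidableEq (PayoffEntry (⊤ : SimpleGraph V) k)] {v u : V} (h : v ≠ u)
    (a b : Fin k) (u' : V) (a' b' : Fin k) :
    pairPayoff v u' a' b' (Pi.single (PayoffEntry.mk (G := ⊤) h a b) 1) =
      if u' = u then (if a' = a then 1 else 0) * (if b' = b then 1 else 0) else 0 := by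
  by_cases hu : v = u'
  · subst hu
    simp [pairPayoff_self, h]
  · rw [pairPayoff_of_ne hu, Pi.single_apply]
    have : (PayoffEntry.mk (G := (⊤ : SimpleGraph V)) hu a' b' = PayoffEntry.mk (G := ⊤) h a b) ↔
        u' = u ∧ a' = a ∧ b' = b := by
      simp only [PayoffEntry.mk, Subtype.mk.injEq, Sym2.eq_iff, Prod.mk.injEq]
      constructor
      · rintro (⟨⟨-, h1⟩, h2, h3⟩ | ⟨⟨h1, -⟩, -⟩)
        · exact ⟨h2, h1, h3⟩
        · exact absurd h1 h
      · rintro ⟨h1, h2, h3⟩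
        exact Or.inl ⟨⟨trivial, h2⟩, h1, h3⟩
    simp only [this]
    split_ifs <;> simp_all

theorem pairPayoff_single_of_ne [DecidableEq (PayoffEntry (⊤ : SimpleGraph V) k)] {v u w : V}
    (h : v ≠ u) (hv : w ≠ v) (hu : w ≠ u) (a b : Fin k) (u' : V) (a' b' : Fin k) :
    pairPayoff w u' a' b' (Pi.single (PayoffEntry.mk (G := ⊤) h a b) 1) = 0 := by
  by_cases hw : w = u'
  · subst hw
    simp [pairPayoff_self]
  · rw [pairPayoff_of_ne hw, Pi.single_eq_of_ne]
    simp only [PayoffEntry.mk, ne_eq, Subtype.mk.injEq, Sym2.eq_iff, Prod.mk.injEq]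
    tauto

variable [Fintype V]

/-- The total gain of player `v` from her own moves at the times in `[p, t]`, as a linear form in
the payoff vector. At a time when another player moves, the summand vanishes. -/
def loopForm (σ : ℕ → V → Fin k) (v : V) (p t : ℕ) :
    (PayoffEntry (⊤ : SimpleGraph V) k → ℝ) →ₗ[ℝ] ℝ :=
  ∑ r ∈ Finset.Ico p (t + 1), ∑ u,
    (pairPayoff v u (σ (r + 1) v) (σ r u) - pairPayoff v u (σ r v) (σ r u))

/-- The coefficient of the total gain of `v` at the payoff entry `A_{vu}(a, b)`. -/
theorem loopForm_single [DecidableEq (PayoffEntry (⊤ : SimpleGraph V) k)] (σ : ℕ → V → Fin k)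
    (p t : ℕ) {v u : V} (h : v ≠ u) (a b : Fin k) :
    loopForm σ v p t (Pi.single (PayoffEntry.mk (G := ⊤) h a b) 1) =
      ∑ r ∈ Finset.Ico p (t + 1),
        ((if σ (r + 1) v = a then 1 else 0) - (if σ r v = a then 1 else 0)) *
          (if σ r u = b then 1 else 0) := by
  simp only [loopForm, LinearMap.sum_apply, LinearMap.sub_apply, pairPayoff_single]
  refine Finset.sum_congr rfl fun r _ => ?_
  rw [Finset.sum_eq_single u]
  · simp only [if_true, sub_mul]
  · intro u' _ hu'
    simp [hu']
  · simp

theorem loopForm_single_of_ne [DecidableEq (PayoffEntry (⊤ : SimpleGraph V) k)]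
    (σ : ℕ → V → Fin k) (p t : ℕ) {v u w : V} (h : v ≠ u) (hv : w ≠ v) (hu : w ≠ u)
    (a b : Fin k) :
    loopForm σ w p t (Pi.single (PayoffEntry.mk (G := ⊤) h a b) 1) = 0 := by
  simp [loopForm, LinearMap.sum_apply, pairPayoff_single_of_ne h hv hu]

theorem one_le_abs_loopForm_single [DecidableEq (PayoffEntry (⊤ : SimpleGraph V) k)]
    (σ : ℕ → V → Fin k) (p t : ℕ) {v u : V} (h : v ≠ u) (a b : Fin k)
    (h0 : loopForm σ v p t (Pi.single (PayoffEntry.mk (G := ⊤) h a b) 1) ≠ 0) :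
    1 ≤ |loopForm σ v p t (Pi.single (PayoffEntry.mk (G := ⊤) h a b) 1)| := by
  obtain ⟨z, hz⟩ : ∃ z : ℤ,
      loopForm σ v p t (Pi.single (PayoffEntry.mk (G := ⊤) h a b) 1) = (z : ℝ) :=
    ⟨∑ r ∈ Finset.Ico p (t + 1),
        ((if σ (r + 1) v = a then 1 else 0) - (if σ r v = a then 1 else 0)) *
          (if σ r u = b then 1 else 0), by rw [loopForm_single]; push_cast; rfl⟩
  rw [hz] at h0 ⊢
  exact_mod_cast Int.one_le_abs (by exact_mod_cast h0)

theorem exists_loopForm_single_ne_zero [DecidableEq (PayoffEntry (⊤ : SimpleGraph V) k)]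
    {σ : ℕ → V → Fin k} {v : V} {p t : ℕ} (h0 : loopForm σ v p t ≠ 0) :
    ∃ (u : V) (h : v ≠ u) (a b : Fin k),
      loopForm σ v p t (Pi.single (PayoffEntry.mk (G := ⊤) h a b) 1) ≠ 0 := by
  classical
  by_contra! hcon
  refine h0 ?_
  refine LinearMap.pi_ext' fun e => LinearMap.ext_ring ?_
  obtain ⟨e, he⟩ := e
  induction e using Sym2.ind with
  | _ q q' =>
    obtain ⟨w, a⟩ := q
    obtain ⟨u, b⟩ := q'
    have hwu : w ≠ u := by simpa using he
    have hmk : (⟨s((w, a), (u, b)), he⟩ : PayoffEntry (⊤ : SimpleGraph V) k) =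
      PayoffEntry.mk (G := ⊤) hwu a b := rfl
    have hmk' : PayoffEntry.mk (G := (⊤ : SimpleGraph V)) hwu a b =
      PayoffEntry.mk (G := ⊤) hwu.symm b a := Subtype.ext Sym2.eq_swap
    rw [hmk]
    simp only [LinearMap.comp_apply, LinearMap.single_apply, LinearMap.zero_apply]
    by_cases hvw : v = w
    · subst hvw
      exact hcon u hwu a b
    by_cases hvu : v = u
    · subst hvu
      rw [hmk']
      exact hcon w hwu.symm b a
    exact loopForm_single_of_ne σ p t hwu hvw hvu a b

/-- The gain forms of the recurrent moves are triangular with unit pivots. Before the epoch of a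
recurrent move of `v` to `j`, some acyclic player `u` moved to a strategy `b`, which she holds
during the whole epoch but held at no earlier time. The move is the first one in the epoch to
involve the strategy `j` of `v`, hence the entry `A_{vu}(j, b)` occurs in its gain form and in none
of the earlier ones. -/
theorem IsMovePath.exists_pivot [DecidableEq (PayoffEntry (⊤ : SimpleGraph V) k)] {ℓ : ℕ}
    {σ : ℕ → V → Fin k} {v : ℕ → V} (hσ : IsMovePath ℓ σ v) {t : ℕ}
    (ht : t ∈ recurrentTimes ℓ σ v) :
    ∃ e, loopForm σ (v t) (lastVisit σ v t) t (Pi.single e 1) = 1 ∧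
      ∀ t' ∈ recurrentTimes ℓ σ v, t' < t →
        loopForm σ (v t') (lastVisit σ v t') t' (Pi.single e 1) = 0 := by
  simp only [recurrentTimes, Finset.mem_filter, Finset.mem_range] at ht
  obtain ⟨htl, hcyc, hfresh, hnot⟩ := ht
  set P : ℕ → Prop := fun r => IsCyclic ℓ σ v (v r) with hP
  set τ := epochStart P t with hτ
  have hτt : τ ≤ t := epochStart_le P t
  have hp := apply_lastVisit hnot
  have hpt := lastVisit_le σ v t
  set p := lastVisit σ v t with hpdef
  set j := σ (t + 1) (v t) with hj
  have hpτ : p < τ := by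
    by_contra hcon
    exact hfresh p (by omega) hpt hp
  have hacyc : ¬ P (τ - 1) := by
    rcases epochStart_spec P t with h | h
    · omega
    · exact h
  set u := v (τ - 1) with hu
  set b := σ τ u with hb
  have hτ1 : τ - 1 + 1 = τ := by omega
  have hvu : v t ≠ u := fun h => hacyc (by rw [hP]; beta_reduce; rw [← hu, ← h]; exact hcyc)
  -- The player `u` first reaches the strategy `b` at time `τ`, and keeps it until time `t`.
  have hbefore : ∀ r, r < τ → σ r u ≠ b := by
    intro r hr
    have hfr : IsFresh σ v 0 (τ - 1) := by
      by_contra hcon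
      exact hacyc ⟨τ - 1, by omega, rfl, hcon⟩
    have := hfr r (Nat.zero_le _) (by omega)
    rwa [hτ1] at this
  have hafter : ∀ r, τ ≤ r → r ≤ t → σ r u = b := by
    intro r hr
    induction r, hr using Nat.le_induction with
    | base => intro _; rfl
    | succ r hr ih =>
      intro hrt
      rw [hσ.off r (by omega) u, ih (by omega)]
      intro hur
      exact hacyc (by
        have : P r := of_epochStart_le hr hrt
        rw [hP] at this ⊢; beta_reduce at this ⊢; rwa [← hu, hur])
  refine ⟨PayoffEntry.mk (G := ⊤) hvu j b, ?_, ?_⟩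
  · rw [loopForm_single, Finset.sum_eq_single t]
    · have h1 : σ t (v t) ≠ j := hfresh t hτt le_rfl
      simp [h1, hafter t hτt le_rfl, ← hj]
    · intro r hr hrt
      rw [Finset.mem_Ico] at hr
      rcases Nat.lt_or_ge r τ with h1 | h1
      · simp [hbefore r h1]
      · have h2 : σ r (v t) ≠ j := hfresh r h1 (by omega)
        have h3 : σ (r + 1) (v t) ≠ j := hfresh (r + 1) (by omega) (by omega)
        simp [h2, h3]
    · intro h
      exact absurd (Finset.mem_Ico.2 ⟨hpt, Nat.lt_succ_self t⟩) h
  · intro t' ht' htt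
    simp only [recurrentTimes, Finset.mem_filter, Finset.mem_range] at ht'
    by_cases hvv : v t' = v t
    · rw [hvv, loopForm_single]
      refine Finset.sum_eq_zero fun r hr => ?_
      rw [Finset.mem_Ico] at hr
      rcases Nat.lt_or_ge r τ with h1 | h1
      · simp [hbefore r h1]
      · have h2 : σ r (v t) ≠ j := hfresh r h1 (by omega)
        have h3 : σ (r + 1) (v t) ≠ j := hfresh (r + 1) (by omega) (by omega)
        simp [h2, h3]
    · refine loopForm_single_of_ne σ _ _ hvu hvv (fun h => hacyc ?_) j b
      rw [hP]; beta_reduce; rw [← hu, ← h]; exact ht'.2.1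

/-- The payoff vectors for which each closed walk of a player through her strategies, from the last
visit of a strategy to the move that returns to it, has a positive total gain of at most `η`. -/
def slowLoopEvent (ℓ : ℕ) (σ : ℕ → V → Fin k) (v : ℕ → V) (η : ℝ) :
    Set (PayoffEntry (⊤ : SimpleGraph V) k → ℝ) :=
  {A | ∀ t < ℓ, ¬ IsFresh σ v 0 t → 0 < loopForm σ (v t) (lastVisit σ v t) t A ∧
    loopForm σ (v t) (lastVisit σ v t) t A ≤ η}

theorem measure_slowLoopEvent_le_of_triangular [Fintype (PayoffEntry (⊤ : SimpleGraph V) k)]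
    [DecidableEq (PayoffEntry (⊤ : SimpleGraph V) k)]
    (ν : PayoffEntry (⊤ : SimpleGraph V) k → Measure ℝ) [∀ e, IsProbabilityMeasure (ν e)]
    {φ : ENNReal} (hν : ∀ e, ν e ≤ φ • volume) (η : ℝ) {ℓ : ℕ}
    {σ : ℕ → V → Fin k} {v : ℕ → V} (s : Finset ℕ) (hs : ∀ t ∈ s, t < ℓ ∧ ¬ IsFresh σ v 0 t)
    (hpivot : ∀ t ∈ s, ∃ e, 1 ≤ |loopForm σ (v t) (lastVisit σ v t) t (Pi.single e 1)| ∧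
      ∀ t' ∈ s, t' < t → loopForm σ (v t') (lastVisit σ v t') t' (Pi.single e 1) = 0) :
    Measure.pi ν (slowLoopEvent ℓ σ v η) ≤ (φ * ENNReal.ofReal (2 * η)) ^ s.card := by
  rcases s.eq_empty_or_nonempty with rfl | ⟨t₀, ht₀⟩
  · simpa using prob_le_one
  have : Nonempty (PayoffEntry (⊤ : SimpleGraph V) k) := ⟨(hpivot t₀ ht₀).choose⟩
  choose! p hp1 hp2 using hpivot
  refine (measure_mono fun A hA t ht => ?_).trans (measure_pi_forall_abs_le_le ν hν
    (fun t => loopForm σ (v t) (lastVisit σ v t) t) p η s hp1 hp2)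
  obtain ⟨h1, h2⟩ := hA t (hs t ht).1 (hs t ht).2
  rwa [abs_of_pos h1]

/-- For a critical path, the slow-loop event forces at least `ℓ / (4 + 6 k)` independent linear
forms to be small. If there are many recurrent moves, their gain forms are used. Otherwise there are
many cyclic players; each has a closed walk, whose gain form has a nonzero coefficient at an entry
shared with some other player `f v`, since the gain is positive. On a set `W` of players such
that `f v ∉ W` for all `v ∈ W`, these forms are diagonal. -/
theorem IsCritical.measure_slowLoopEvent_le [Fintype (PayoffEntry (⊤ : SimpleGraph V) k)]
    (ν : PayoffEntry (⊤ : SimpleGraph V) k → Measure ℝ) [∀ e, IsProbabilityMeasure (ν e)]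
    {φ : ENNReal} (hν : ∀ e, ν e ≤ φ • volume) (η : ℝ) {ℓ : ℕ}
    {σ : ℕ → V → Fin k} {v : ℕ → V} (h : IsCritical ℓ σ v) :
    ∃ r, ℓ ≤ (4 + 6 * k) * r ∧
      Measure.pi ν (slowLoopEvent ℓ σ v η) ≤ (φ * ENNReal.ofReal (2 * η)) ^ r := by
  classical
  -- If the gain form of some closed walk vanishes identically, the gain cannot be positive.
  by_cases hz : ∃ t < ℓ, ¬ IsFresh σ v 0 t ∧ loopForm σ (v t) (lastVisit σ v t) t = 0
  · obtain ⟨t, ht, hnot, hz⟩ := hz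
    refine ⟨ℓ, by nlinarith, ?_⟩
    have : slowLoopEvent ℓ σ v η = ∅ := by
      refine Set.eq_empty_of_forall_notMem fun A hA => ?_
      have := (hA t ht hnot).1
      simp [hz] at this
    simp [this]
  push Not at hz
  have hcount := h.le_recurrent_add_cyclic
  have hcyc : ∀ w ∈ cyclicPlayers ℓ σ v, ∃ t < ℓ, v t = w ∧ ¬ IsFresh σ v 0 t := by
    intro w hw
    simpa [cyclicPlayers, IsCyclic] using hw
  choose! T hTl hTv hTf using hcyc
  have hcoef : ∀ w ∈ cyclicPlayers ℓ σ v, ∃ (u : V) (h : w ≠ u) (a b : Fin k),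
      loopForm σ w (lastVisit σ v (T w)) (T w)
        (Pi.single (PayoffEntry.mk (G := ⊤) h a b) 1) ≠ 0 := by
    intro w hw
    have := hz (T w) (hTl w hw) (hTf w hw)
    rw [hTv w hw] at this
    exact exists_loopForm_single_ne_zero this
  choose! f hf using hcoef
  obtain ⟨W, hWC, hcard, hW⟩ := exists_subset_card_le_three_mul f (cyclicPlayers ℓ σ v)
    (fun w hw => (hf w hw).choose.symm)
  have hA := measure_slowLoopEvent_le_of_triangular ν hν η (recurrentTimes ℓ σ v)
    (fun t ht => by
      simp only [recurrentTimes, Finset.mem_filter, Finset.mem_range] at ht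
      exact ⟨ht.1, ht.2.2.2⟩)
    (fun t ht => by
      obtain ⟨e, he1, he2⟩ := h.toIsMovePath.exists_pivot ht
      exact ⟨e, by simp [he1], he2⟩)
  have hB := measure_slowLoopEvent_le_of_triangular ν hν η (W.image T)
    (fun t ht => by
      obtain ⟨w, hw, rfl⟩ := Finset.mem_image.1 ht
      exact ⟨hTl w (hWC hw), hTf w (hWC hw)⟩)
    (fun t ht => by
      obtain ⟨w, hw, rfl⟩ := Finset.mem_image.1 ht
      obtain ⟨hne, a, b, hab⟩ := hf w (hWC hw)
      rw [hTv w (hWC hw)]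
      refine ⟨_, one_le_abs_loopForm_single σ _ _ hne a b hab, fun t' ht' hlt => ?_⟩
      obtain ⟨w', hw', rfl⟩ := Finset.mem_image.1 ht'
      rw [hTv w' (hWC hw')]
      refine loopForm_single_of_ne σ _ _ hne ?_ ?_ a b
      · rintro rfl; exact lt_irrefl _ hlt
      · rintro rfl; exact hW w hw hw')
  rw [Finset.card_image_of_injOn (fun w hw w' hw' hww => by
    rw [← hTv w (hWC hw), ← hTv w' (hWC hw')]; exact congrArg v hww)] at hB
  rcases le_total W.card (recurrentTimes ℓ σ v).card with hle | hle
  · exact ⟨_, by nlinarith, hA⟩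
  · exact ⟨_, by nlinarith, hB⟩

end Loop

/-! ### Encoding of paths and the union bound -/

section Replay

variable {V : Type*} {k : ℕ}

/-- On a closed walk of `v`, the contribution of a player who does not move telescopes to zero, so
the gain form does not depend on the strategy of that player. -/
theorem loopForm_congr [DecidableEq V] [Fintype V] {σ ρ : ℕ → V → Fin k} {v : V} {p t : ℕ}
    (hpt : p ≤ t) (hv : ∀ r, p ≤ r → r ≤ t + 1 → ρ r v = σ r v) (hloop : σ p v = σ (t + 1) v)
    (hu : ∀ u, (∀ r, p ≤ r → r ≤ t → ρ r u = σ r u) ∨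
      ∃ a b, ∀ r, p ≤ r → r ≤ t → ρ r u = a ∧ σ r u = b) :
    loopForm ρ v p t = loopForm σ v p t := by
  have htel : ∀ u (c : Fin k), ∑ r ∈ Finset.Ico p (t + 1),
      (pairPayoff v u (σ (r + 1) v) c - pairPayoff v u (σ r v) c) = 0 := by
    intro u c
    rw [Finset.sum_Ico_sub (fun r => pairPayoff v u (σ r v) c) (by omega), hloop, sub_self]
  rw [loopForm, loopForm, Finset.sum_comm, Finset.sum_comm (s := Finset.Ico p (t + 1))]
  refine Finset.sum_congr rfl fun u _ => ?_
  rcases hu u with h | ⟨a, b, h⟩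
  · refine Finset.sum_congr rfl fun r hr => ?_
    rw [Finset.mem_Ico] at hr
    rw [hv r hr.1 (by omega), hv (r + 1) (by omega) (by omega), h r hr.1 (by omega)]
  · have e1 : ∑ r ∈ Finset.Ico p (t + 1),
        (pairPayoff v u (ρ (r + 1) v) (ρ r u) - pairPayoff v u (ρ r v) (ρ r u)) =
        ∑ r ∈ Finset.Ico p (t + 1),
          (pairPayoff v u (σ (r + 1) v) a - pairPayoff v u (σ r v) a) := by
      refine Finset.sum_congr rfl fun r hr => ?_
      rw [Finset.mem_Ico] at hr
      rw [hv r hr.1 (by omega), hv (r + 1) (by omega) (by omega), (h r hr.1 (by omega)).1]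
    have e2 : ∑ r ∈ Finset.Ico p (t + 1),
        (pairPayoff v u (σ (r + 1) v) (σ r u) - pairPayoff v u (σ r v) (σ r u)) =
        ∑ r ∈ Finset.Ico p (t + 1),
          (pairPayoff v u (σ (r + 1) v) b - pairPayoff v u (σ r v) b) := by
      refine Finset.sum_congr rfl fun r hr => ?_
      rw [Finset.mem_Ico] at hr
      rw [(h r hr.1 (by omega)).2]
    rw [e1, e2, htel, htel]

theorem IsMovePath.loopForm_mem [DecidableEq V] [Fintype V] {ℓ : ℕ} {σ : ℕ → V → Fin k}
    {v : ℕ → V} (hσ : IsMovePath ℓ σ v) {A : PayoffEntry (⊤ : SimpleGraph V) k → ℝ} {ε : ℝ}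
    (hgain : ∀ t < ℓ, payoff A (σ t) (v t) < payoff A (σ (t + 1)) (v t))
    (hslow : ∀ t < ℓ, payoff A (σ (t + 1)) (v t) - payoff A (σ t) (v t) ≤ ε)
    {p t : ℕ} (hpt : p ≤ t) (ht : t < ℓ) :
    0 < loopForm σ (v t) p t A ∧ loopForm σ (v t) p t A ≤ ℓ * ε := by
  have hterm : ∀ r < ℓ, ∑ u, (pairPayoff (v t) u (σ (r + 1) (v t)) (σ r u) A -
      pairPayoff (v t) u (σ r (v t)) (σ r u) A) =
      if v r = v t then payoff A (σ (r + 1)) (v r) - payoff A (σ r) (v r) else 0 := by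
    intro r hr
    split_ifs with hvr
    · rw [← hvr, payoff_eq_sum_pairPayoff, payoff_eq_sum_pairPayoff, ← Finset.sum_sub_distrib]
      refine Finset.sum_congr rfl fun u _ => ?_
      by_cases hu : u = v r
      · subst hu; simp [pairPayoff_self]
      · rw [hσ.off r hr u hu]
    · rw [hσ.off r hr (v t) (Ne.symm hvr)]
      simp
  have hsum : loopForm σ (v t) p t A = ∑ r ∈ Finset.Ico p (t + 1),
      if v r = v t then payoff A (σ (r + 1)) (v r) - payoff A (σ r) (v r) else 0 := by
    simp only [loopForm, LinearMap.sum_apply, LinearMap.sub_apply]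
    refine Finset.sum_congr rfl fun r hr => hterm r ?_
    rw [Finset.mem_Ico] at hr
    omega
  have hε : 0 < ε := by linarith [hgain t ht, hslow t ht]
  rw [hsum]
  constructor
  · refine Finset.sum_pos' (fun r hr => ?_) ⟨t, Finset.mem_Ico.2 ⟨hpt, by omega⟩, ?_⟩
    · rw [Finset.mem_Ico] at hr
      split_ifs
      · linarith [hgain r (by omega)]
      · exact le_rfl
    · rw [if_pos rfl]
      linarith [hgain t ht]
  · refine (Finset.sum_le_card_nsmul _ _ ε fun r hr => ?_).trans ?_
    · rw [Finset.mem_Ico] at hr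
      split_ifs
      · exact hslow r (by omega)
      · exact hε.le
    · rw [nsmul_eq_mul, Nat.card_Ico]
      have : ((t + 1 - p : ℕ) : ℝ) ≤ ℓ := by exact_mod_cast (by omega)
      gcongr

open Classical in
/-- The sequence of profiles encoded by a list `d` of length `ℓ`, whose entries are the moving
player, her strategy at time `0`, and the strategy to which she moves. Players who never move hold
the strategy `0`, and nothing moves from time `ℓ` on. -/
noncomputable def replay [NeZero k] {ℓ : ℕ} (d : Fin ℓ → V × Fin k × Fin k) : ℕ → V → Fin k
  | 0 => fun u => if h : ∃ r, (d r).1 = u then (d h.choose).2.1 else 0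
  | t + 1 => fun u => if h : t < ℓ then
      Function.update (replay d t) (d ⟨t, h⟩).1 (d ⟨t, h⟩).2.2 u else replay d t u

/-- The player who moves at time `t < ℓ` in the list `d`; an arbitrary player for `t ≥ ℓ`. -/
noncomputable def replayMover [Nonempty V] {ℓ : ℕ} (d : Fin ℓ → V × Fin k × Fin k) (t : ℕ) : V :=
  if h : t < ℓ then (d ⟨t, h⟩).1 else Classical.arbitrary V

/-- The list that encodes the first `ℓ` moves of a path, up to the strategies of players who never
move. -/
def record (ℓ : ℕ) (σ : ℕ → V → Fin k) (v : ℕ → V) (r : Fin ℓ) : V × Fin k × Fin k :=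
  (v r, σ 0 (v r), σ (r + 1) (v r))

theorem replayMover_record [Nonempty V] {ℓ : ℕ} (σ : ℕ → V → Fin k) (v : ℕ → V) {t : ℕ}
    (ht : t < ℓ) : replayMover (record ℓ σ v) t = v t := by
  simp [replayMover, ht, record]

theorem IsMovePath.replay_record_apply [NeZero k] {ℓ : ℕ} {σ : ℕ → V → Fin k} {v : ℕ → V}
    (hσ : IsMovePath ℓ σ v) {u : V} (hu : ∃ r < ℓ, v r = u) {t : ℕ} (ht : t ≤ ℓ) :
    replay (record ℓ σ v) t u = σ t u := by
  classical
  induction t with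
  | zero =>
    have h : ∃ r, (record ℓ σ v r).1 = u := by
      obtain ⟨r, hr, rfl⟩ := hu
      exact ⟨⟨r, hr⟩, rfl⟩
    simp only [replay, h, dif_pos]
    have := h.choose_spec
    simp only [record] at this ⊢
    rw [this]
  | succ t ih =>
    have ih := ih (by omega)
    simp only [replay, show t < ℓ from ht, dif_pos]
    by_cases h : u = v t
    · subst h; simp [record]
    · rw [Function.update_of_ne (by simpa [record] using h), ih, hσ.off t ht u h]

theorem replay_record_of_forall_ne [NeZero k] {ℓ : ℕ} (σ : ℕ → V → Fin k) {v : ℕ → V} {u : V}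
    (hu : ∀ r < ℓ, v r ≠ u) (t : ℕ) : replay (record ℓ σ v) t u = 0 := by
  classical
  induction t with
  | zero =>
    have h : ¬ ∃ r, (record ℓ σ v r).1 = u := fun ⟨r, hr⟩ => hu r r.2 hr
    simp only [replay, h, dif_neg, not_false_eq_true]
  | succ t ih =>
    simp only [replay]
    split_ifs with h
    · rw [Function.update_of_ne (by simpa [record] using (hu t h).symm), ih]
    · exact ih

theorem IsMovePath.isFresh_replay_record [NeZero k] [Nonempty V] {ℓ : ℕ} {σ : ℕ → V → Fin k}
    {v : ℕ → V} (hσ : IsMovePath ℓ σ v) (x : ℕ) {t : ℕ} (ht : t < ℓ) :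
    IsFresh (replay (record ℓ σ v)) (replayMover (record ℓ σ v)) x t ↔ IsFresh σ v x t := by
  refine forall_congr' fun r => forall₂_congr fun _ hr => ?_
  rw [replayMover_record σ v ht, hσ.replay_record_apply ⟨t, ht, rfl⟩ (by omega),
    hσ.replay_record_apply ⟨t, ht, rfl⟩ (by omega)]

theorem IsCritical.replay_record [NeZero k] [Nonempty V] {ℓ : ℕ} {σ : ℕ → V → Fin k}
    {v : ℕ → V} (h : IsCritical ℓ σ v) :
    IsCritical ℓ (replay (record ℓ σ v)) (replayMover (record ℓ σ v)) := by
  have hσ := h.toIsMovePath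
  have hfresh : ∀ x y, y ≤ ℓ → freshTimes (replay (record ℓ σ v)) (replayMover (record ℓ σ v)) x y =
      freshTimes σ v x y := by
    intro x y hy
    ext t
    rw [mem_freshTimes, mem_freshTimes]
    refine and_congr_right fun ht => hσ.isFresh_replay_record x (by omega)
  refine ⟨⟨fun t ht u hu => ?_, fun t ht => ?_⟩, h.pos, ?_, fun x y hy => ?_⟩
  · rw [replayMover_record σ v ht] at hu
    by_cases hmov : ∃ r < ℓ, v r = u
    · rw [hσ.replay_record_apply hmov (by omega), hσ.replay_record_apply hmov ht.le,
        hσ.off t ht u hu]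
    · push Not at hmov
      rw [replay_record_of_forall_ne σ hmov, replay_record_of_forall_ne σ hmov]
  · rw [replayMover_record σ v ht, hσ.replay_record_apply ⟨t, ht, rfl⟩ (by omega),
      hσ.replay_record_apply ⟨t, ht, rfl⟩ (by omega)]
    exact hσ.ne t ht
  · rw [hfresh 0 ℓ le_rfl]; exact h.whole
  · rw [hfresh x y hy]; exact h.sub x y hy

theorem IsMovePath.mem_slowLoopEvent_replay_record [DecidableEq V] [Fintype V] [NeZero k]
    [Nonempty V] {ℓ : ℕ} {σ : ℕ → V → Fin k}
    {v : ℕ → V} (hσ : IsMovePath ℓ σ v) {A : PayoffEntry (⊤ : SimpleGraph V) k → ℝ} {ε : ℝ}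
    (hgain : ∀ t < ℓ, payoff A (σ t) (v t) < payoff A (σ (t + 1)) (v t))
    (hslow : ∀ t < ℓ, payoff A (σ (t + 1)) (v t) - payoff A (σ t) (v t) ≤ ε) :
    A ∈ slowLoopEvent ℓ (replay (record ℓ σ v)) (replayMover (record ℓ σ v)) (ℓ * ε) := by
  intro t ht hnot
  have hclosed := apply_lastVisit hnot
  have hpt := lastVisit_le (replay (record ℓ σ v)) (replayMover (record ℓ σ v)) t
  set p := lastVisit (replay (record ℓ σ v)) (replayMover (record ℓ σ v)) t
  rw [replayMover_record σ v ht] at hclosed ⊢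
  have hmov : ∃ r < ℓ, v r = v t := ⟨t, ht, rfl⟩
  rw [hσ.replay_record_apply hmov (by omega), hσ.replay_record_apply hmov (by omega)] at hclosed
  rw [loopForm_congr hpt (fun r _ _ => hσ.replay_record_apply hmov (by omega)) hclosed]
  · exact hσ.loopForm_mem hgain hslow hpt ht
  · intro u
    by_cases hu : ∃ r < ℓ, v r = u
    · exact Or.inl fun r _ _ => hσ.replay_record_apply hu (by omega)
    · push Not at hu
      refine Or.inr ⟨0, σ 0 u, fun r _ hr => ⟨replay_record_of_forall_ne σ hu r, ?_⟩⟩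
      have : ∀ r ≤ ℓ, σ r u = σ 0 u := by
        intro r
        induction r with
        | zero => intro _; rfl
        | succ r ih =>
          intro hr
          rw [hσ.off r hr u (hu r hr).symm, ih (by omega)]
      exact this r (by omega)

/-- The payoff vectors for which, on some critical path of length `ℓ ≤ 2 n k` in which the players
who never move hold the strategy `0`, every closed walk has a positive total gain of at most `ℓ ε`.
-/
def slowEvent (V : Type*) [DecidableEq V] [Fintype V] [Nonempty V] (k : ℕ) [NeZero k] (ε : ℝ) :
    Set (PayoffEntry (⊤ : SimpleGraph V) k → ℝ) :=
  ⋃ ℓ ∈ Finset.Icc 1 (2 * (Fintype.card V * k)), ⋃ d : Fin ℓ → V × Fin k × Fin k,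
    {A | IsCritical ℓ (replay d) (replayMover d) ∧
      A ∈ slowLoopEvent ℓ (replay d) (replayMover d) (ℓ * ε)}

/-- If all of `2 n k` consecutive better-response moves gain at most `ε`, the payoff vector lies in
the slow event. -/
theorem IsMovePath.mem_slowEvent [DecidableEq V] [Fintype V] [NeZero k]
    [Nonempty V] {σ : ℕ → V → Fin k} {v : ℕ → V}
    (hσ : IsMovePath (2 * (Fintype.card V * k)) σ v)
    {A : PayoffEntry (⊤ : SimpleGraph V) k → ℝ} {ε : ℝ}
    (hgain : ∀ t < 2 * (Fintype.card V * k),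
      payoff A (σ t) (v t) < payoff A (σ (t + 1)) (v t))
    (hslow : ∀ t < 2 * (Fintype.card V * k),
      payoff A (σ (t + 1)) (v t) - payoff A (σ t) (v t) ≤ ε) :
    A ∈ slowEvent V k ε := by
  have hpos : 0 < 2 * (Fintype.card V * k) := by
    have := Fintype.card_pos (α := V)
    have := NeZero.pos k
    positivity
  obtain ⟨s, ℓ, hsℓ, hcrit⟩ := hσ.exists_isCritical le_rfl hpos
  simp only [slowEvent, Set.mem_iUnion, Finset.mem_Icc]
  refine ⟨ℓ, ⟨hcrit.pos, by omega⟩, record ℓ _ _, hcrit.replay_record, ?_⟩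
  exact hcrit.toIsMovePath.mem_slowLoopEvent_replay_record
    (fun t ht => hgain (s + t) (by omega)) (fun t ht => hslow (s + t) (by omega))

/-- The union bound over the `(n k ^ 2) ^ ℓ` encoded paths of each length `ℓ`. A critical path of
length `ℓ` has probability at most `(4 n k φ ε) ^ r` with `ℓ ≤ (4 + 6 k) r`, so the number of paths
is paid for when `ε` is small enough in terms of `(n k ^ 2) ^ (4 + 6 k)`. -/
theorem measure_slowEvent_le [DecidableEq V] [Fintype V] [NeZero k] [Nonempty V]
    [Fintype (PayoffEntry (⊤ : SimpleGraph V) k)]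
    (ν : PayoffEntry (⊤ : SimpleGraph V) k → Measure ℝ) [∀ e, IsProbabilityMeasure (ν e)]
    {φ : ENNReal} (hν : ∀ e, ν e ≤ φ • volume) {ε : ℝ} (hε : 0 ≤ ε) {δ : ENNReal} (hδ : δ ≤ 1)
    (h : ((Fintype.card V * k ^ 2 : ℕ) : ENNReal) ^ (4 + 6 * k) *
      (φ * ENNReal.ofReal (2 * ((2 * (Fintype.card V * k) : ℕ) * ε))) ≤ δ) :
    Measure.pi ν (slowEvent V k ε) ≤ (2 * (Fintype.card V * k) : ℕ) * δ := by
  have hq : 1 ≤ ((Fintype.card V * k ^ 2 : ℕ) : ENNReal) := by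
    have := Fintype.card_pos (α := V)
    have := NeZero.pos k
    exact_mod_cast Nat.one_le_iff_ne_zero.2 (by positivity)
  set q := ((Fintype.card V * k ^ 2 : ℕ) : ENNReal) with hqdef
  set L := 2 * (Fintype.card V * k)
  have hsingle : ∀ ℓ ∈ Finset.Icc 1 L, ∀ d : Fin ℓ → V × Fin k × Fin k,
      q ^ ℓ * Measure.pi ν {A | IsCritical ℓ (replay d) (replayMover d) ∧
        A ∈ slowLoopEvent ℓ (replay d) (replayMover d) (ℓ * ε)} ≤ δ := by
    intro ℓ hℓ d
    rw [Finset.mem_Icc] at hℓ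
    by_cases hcrit : IsCritical ℓ (replay d) (replayMover d)
    · obtain ⟨r, hr, hmeas⟩ := hcrit.measure_slowLoopEvent_le ν hν (ℓ * ε)
      have hr0 : r ≠ 0 := by rintro rfl; omega
      calc q ^ ℓ * Measure.pi ν {A | IsCritical ℓ (replay d) (replayMover d) ∧
            A ∈ slowLoopEvent ℓ (replay d) (replayMover d) (ℓ * ε)}
          ≤ q ^ ((4 + 6 * k) * r) * (φ * ENNReal.ofReal (2 * (L * ε))) ^ r := by
            refine mul_le_mul' (pow_le_pow_right₀ hq hr)
              (((measure_mono fun A hA => hA.2).trans hmeas).trans ?_)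
            have : (ℓ : ℝ) ≤ L := by exact_mod_cast hℓ.2
            gcongr
        _ = (q ^ (4 + 6 * k) * (φ * ENNReal.ofReal (2 * (L * ε)))) ^ r := by
            rw [pow_mul, ← mul_pow]
        _ ≤ δ ^ r := pow_le_pow_left' h r
        _ ≤ δ := pow_le_of_le_one (zero_le) hδ hr0
    · simp [hcrit]
  have hcard : ∀ ℓ, ((Fintype.card (Fin ℓ → V × Fin k × Fin k) : ℕ) : ENNReal) = q ^ ℓ := by
    intro ℓ
    simp only [Fintype.card_fun, Fintype.card_prod, Fintype.card_fin, hqdef]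
    push_cast
    ring
  have hlen : ∀ ℓ ∈ Finset.Icc 1 L, Measure.pi ν (⋃ d : Fin ℓ → V × Fin k × Fin k,
      {A | IsCritical ℓ (replay d) (replayMover d) ∧
        A ∈ slowLoopEvent ℓ (replay d) (replayMover d) (ℓ * ε)}) ≤ δ := by
    intro ℓ hℓ
    refine (measure_iUnion_fintype_le _ _).trans ?_
    have hq0 : q ^ ℓ ≠ 0 := (zero_lt_one.trans_le (one_le_pow₀ hq)).ne'
    have hqt : q ^ ℓ ≠ ⊤ := ENNReal.pow_ne_top (ENNReal.natCast_ne_top _)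
    calc _ ≤ ∑ _d : Fin ℓ → V × Fin k × Fin k, δ / q ^ ℓ :=
          Finset.sum_le_sum fun d _ => by
            rw [ENNReal.le_div_iff_mul_le (Or.inl hq0) (Or.inl hqt), mul_comm]
            exact hsingle ℓ hℓ d
      _ = δ := by
          rw [Finset.sum_const, nsmul_eq_mul, Finset.card_univ, hcard,
            ENNReal.mul_div_cancel hq0 hqt]
  calc Measure.pi ν (slowEvent V k ε) ≤ ∑ ℓ ∈ Finset.Icc 1 L, _ :=
        measure_biUnion_finset_le _ _
    _ ≤ ∑ ℓ ∈ Finset.Icc 1 L, δ := Finset.sum_le_sum hlen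
    _ = L * δ := by rw [Finset.sum_const, nsmul_eq_mul, Nat.card_Icc, Nat.add_sub_cancel]

end Replay

/-! ### Smoothed instances and the potential argument -/

theorem IsSmoothedInstance.map_le {V : Type*} {k : ℕ} {Ω : Type*} [MeasurableSpace Ω]
    {μ : Measure Ω}
    {G : SimpleGraph V} {φ : ℝ} {A : PayoffEntry G k → Ω → ℝ} (h : IsSmoothedInstance G k φ μ A)
    (e : PayoffEntry G k) : μ.map (A e) ≤ ENNReal.ofReal φ • volume := by
  have := h.hasPDF e
  rw [map_eq_withDensity_pdf (A e) μ volume, ← withDensity_const]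
  exact withDensity_mono (h.pdf_le e)

/-- A probability density on `[-1, 1]` that is bounded by `φ` forces `φ ≥ 1 / 2`. -/
theorem IsSmoothedInstance.one_le_two_mul {V : Type*} {k : ℕ} {Ω : Type*} [MeasurableSpace Ω]
    {μ : Measure Ω} [IsProbabilityMeasure μ]
    {G : SimpleGraph V} {φ : ℝ} {A : PayoffEntry G k → Ω → ℝ} (h : IsSmoothedInstance G k φ μ A)
    (e : PayoffEntry G k) : 1 ≤ 2 * φ := by
  have := h.hasPDF e
  have hm : AEMeasurable (A e) μ := HasPDF.aemeasurable (A e) μ volume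
  have h1 : μ.map (A e) (Set.Icc (-1) 1) = 1 := by
    rw [Measure.map_apply_of_aemeasurable hm measurableSet_Icc]
    exact (prob_compl_eq_zero_iff₀ (hm.nullMeasurable measurableSet_Icc)).1 (h.supported e)
  have h2 := h.map_le e (Set.Icc (-1) 1)
  rw [h1, Measure.smul_apply, Real.volume_Icc, smul_eq_mul,
    ← ENNReal.ofReal_mul' (by norm_num), ENNReal.one_le_ofReal] at h2
  linarith

section Dynamics

variable {V : Type*} [DecidableEq V] [Fintype V] {k : ℕ}

/-- Half the sum of all payoffs is an exact potential. -/
theorem sum_payoff_update_sub (A : PayoffEntry (⊤ : SimpleGraph V) k → ℝ) (σ : V → Fin k) (v : V)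
    (i : Fin k) :
    ∑ u, payoff A (Function.update σ v i) u - ∑ u, payoff A σ u =
      2 * (payoff A (Function.update σ v i) v - payoff A σ v) := by
  set σ' := Function.update σ v i with hσ'
  have hoff : ∀ u, u ≠ v → σ' u = σ u := fun u hu => Function.update_of_ne hu _ _
  set D : V → V → ℝ := fun u w =>
    pairPayoff u w (σ' u) (σ' w) A - pairPayoff u w (σ u) (σ w) A with hD
  have hcomm : ∀ u w, D u w = D w u := fun u w => by
    simp only [hD]; rw [pairPayoff_comm, pairPayoff_comm u w (σ u)]
  have hpay : ∀ u, payoff A σ' u - payoff A σ u = ∑ w, D u w := fun u => by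
    rw [payoff_eq_sum_pairPayoff, payoff_eq_sum_pairPayoff, ← Finset.sum_sub_distrib]
  -- Only the row and the column of the moving player change, by equal amounts.
  have hrow : ∀ u, ∑ w, D u w = D v u + if u = v then ∑ w, D v w else 0 := by
    intro u
    split_ifs with hu
    · subst hu; simp [hD, pairPayoff_self]
    · rw [add_zero, hcomm v u, Finset.sum_eq_single v]
      · intro w _ hw
        simp [hD, hoff u hu, hoff w hw]
      · simp
  rw [← Finset.sum_sub_distrib, hpay v]
  simp only [hpay]
  rw [Finset.sum_congr rfl fun u _ => hrow u, Finset.sum_add_distrib, Finset.sum_ite_eq']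
  simp only [Finset.mem_univ, if_true]
  ring

theorem abs_sum_payoff_le {A : PayoffEntry (⊤ : SimpleGraph V) k → ℝ}
    (hA : ∀ e, A e ∈ Set.Icc (-1 : ℝ) 1) (σ : V → Fin k) :
    |∑ u, payoff A σ u| ≤ (Fintype.card V : ℝ) ^ 2 := by
  have hpair : ∀ u w, |pairPayoff u w (σ u) (σ w) A| ≤ 1 := by
    intro u w
    by_cases h : u = w
    · subst h; simp [pairPayoff_self]
    · rw [pairPayoff_of_ne h, abs_le]
      exact hA _
  calc |∑ u, payoff A σ u| ≤ ∑ u, ∑ w, |pairPayoff u w (σ u) (σ w) A| := by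
        refine (Finset.abs_sum_le_sum_abs _ _).trans (Finset.sum_le_sum fun u _ => ?_)
        rw [payoff_eq_sum_pairPayoff]
        exact Finset.abs_sum_le_sum_abs _ _
    _ ≤ ∑ _u : V, ∑ _w : V, (1 : ℝ) :=
        Finset.sum_le_sum fun u _ => Finset.sum_le_sum fun w _ => hpair u w
    _ = (Fintype.card V : ℝ) ^ 2 := by simp [sq]

/-- Outside the slow event, each block of `2 n k` moves contains one that gains more than `ε`, and
so raises the sum of all payoffs by more than `2 ε`. This sum stays in `[-n ^ 2, n ^ 2]`. -/
theorem IsBRExecution.exists_isPNE [NeZero k] [Nonempty V]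
    {A : PayoffEntry (⊤ : SimpleGraph V) k → ℝ} (hA : ∀ e, A e ∈ Set.Icc (-1 : ℝ) 1) {ε : ℝ}
    (hslow : A ∉ slowEvent V k ε) {M : ℕ} (hM : (Fintype.card V : ℝ) ^ 2 < M * ε)
    {σ : ℕ → V → Fin k} (hσ : IsBRExecution A σ) :
    ∃ t ≤ 2 * (Fintype.card V * k) * M, IsPNE A (σ t) := by
  by_contra! hcon
  set L := 2 * (Fintype.card V * k) with hL
  have hmove : ∀ t, ∃ v, t < L * M →
      (∀ u, u ≠ v → σ (t + 1) u = σ t u) ∧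
      payoff A (σ t) v < payoff A (σ (t + 1)) v ∧
      ∑ u, payoff A (σ (t + 1)) u - ∑ u, payoff A (σ t) u =
        2 * (payoff A (σ (t + 1)) v - payoff A (σ t) v) := by
    intro t
    by_cases ht : t < L * M
    · rcases hσ t with ⟨-, v, i, h1, h2⟩ | ⟨h1, -⟩
      · refine ⟨v, fun _ => ⟨fun u hu => ?_, h2, ?_⟩⟩
        · rw [h1, Function.update_of_ne hu]
        · rw [h1]; exact sum_payoff_update_sub A (σ t) v i
      · exact absurd h1 (hcon t ht.le)
    · exact ⟨Classical.arbitrary V, fun h => absurd h ht⟩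
  choose v hv using hmove
  set Φ : ℕ → ℝ := fun t => ∑ u, payoff A (σ t) u with hΦ
  have hstep : ∀ t < L * M, Φ t ≤ Φ (t + 1) := by
    intro t ht
    have h1 := (hv t ht).2.1
    have h2 := (hv t ht).2.2
    simp only [hΦ]
    linarith
  have hmono : ∀ s t, s ≤ t → t ≤ L * M → Φ s ≤ Φ t := by
    intro s t hst
    induction t, hst using Nat.le_induction with
    | base => intro _; exact le_rfl
    | succ t _ ih => intro ht; exact (ih (by omega)).trans (hstep t (by omega))
  have hblock : ∀ m ≤ M, Φ 0 + m * (2 * ε) ≤ Φ (L * m) := by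
    intro m
    induction m with
    | zero => intro _; simp
    | succ m ih =>
      intro hm
      have hend : L * m + L ≤ L * M := by
        calc L * m + L = L * (m + 1) := by ring
          _ ≤ L * M := Nat.mul_le_mul_left L hm
      have hpath : IsMovePath L (fun t => σ (L * m + t)) (fun t => v (L * m + t)) := by
        refine ⟨fun t ht u hu => (hv (L * m + t) (by omega)).1 u hu, fun t ht heq => ?_⟩
        have h1 := hv (L * m + t) (by omega)
        have h2 : σ (L * m + t + 1) = σ (L * m + t) := by
          funext u
          by_cases hu : u = v (L * m + t)
          · rw [hu]; exact heq
          · exact h1.1 u hu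
        have := h1.2.1
        rw [h2] at this
        exact lt_irrefl _ this
      obtain ⟨t, ht, hfast⟩ : ∃ t < L, ε <
          payoff A (σ (L * m + t + 1)) (v (L * m + t)) -
            payoff A (σ (L * m + t)) (v (L * m + t)) := by
        by_contra! hall
        exact hslow (hpath.mem_slowEvent (fun t ht => (hv (L * m + t) (by omega)).2.1)
          (fun t ht => hall t ht))
      have h1 := hmono (L * m) (L * m + t) (by omega) (by omega)
      have h2 := hmono (L * m + t + 1) (L * (m + 1)) (by rw [mul_add]; omega)
        (by rw [mul_add]; omega)
      have h3 := (hv (L * m + t) (by omega)).2.2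
      have h4 := ih (by omega)
      push_cast
      simp only [hΦ] at h1 h2 h4 ⊢
      linarith
  have h1 := hblock M le_rfl
  have h2 := abs_le.1 (abs_sum_payoff_le hA (σ 0))
  have h3 := abs_le.1 (abs_sum_payoff_le hA (σ (L * M)))
  simp only [hΦ] at h1
  linarith

theorem isPNE_of_subsingleton [Subsingleton (Fin k)]
    (A : PayoffEntry (⊤ : SimpleGraph V) k → ℝ) (σ : V → Fin k) : IsPNE A σ := fun u i => by
  rw [Subsingleton.elim (Function.update σ u i) σ]

theorem isPNE_of_subsingleton_players [Subsingleton V]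
    (A : PayoffEntry (⊤ : SimpleGraph V) k → ℝ) (σ : V → Fin k) : IsPNE A σ := fun u i => by
  simp only [payoff_eq_sum_pairPayoff]
  refine Finset.sum_le_sum fun w _ => ?_
  rw [Subsingleton.elim w u]
  simp [pairPayoff_self]

/-- The nondegenerate case, with `N = n k φ ≥ 2`, `ε = N ^ (-(36 + c) k)` and `C = 40 + c`. -/
theorem measure_exists_slow_execution_le {c : ℕ} {φ : ℝ} [NeZero k] [Nonempty V]
    (hN : 2 ≤ Fintype.card V * k * φ) (hφ : 1 ≤ 2 * φ) (hk : 2 ≤ k)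
    {Ω : Type*} [MeasurableSpace Ω] (μ : Measure Ω) [IsProbabilityMeasure μ]
    (A : PayoffEntry (⊤ : SimpleGraph V) k → Ω → ℝ) (hA : IsSmoothedInstance ⊤ k φ μ A) :
    μ {ω | ¬ ∀ σ : ℕ → V → Fin k, IsBRExecution (fun e => A e ω) σ →
      ∃ t : ℕ, (t : ℝ) ≤ ((Fintype.card V : ℝ) * k * φ) ^ ((40 + c) * k) ∧
        IsPNE (fun e => A e ω) (σ t)} ≤
      ENNReal.ofReal (1 / ((Fintype.card V : ℝ) * k * φ) ^ c) := by
  classical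
  have : Fintype (PayoffEntry (⊤ : SimpleGraph V) k) := Fintype.ofFinite _
  set n := Fintype.card V with hn
  set N : ℝ := n * k * φ with hNdef
  have hn1 : (1 : ℝ) ≤ n := by exact_mod_cast Fintype.card_pos (α := V)
  have hk2 : (2 : ℝ) ≤ k := by exact_mod_cast hk
  have hφ0 : 0 ≤ φ := by linarith
  have hN0 : 0 < N := by linarith
  have hN1 : 1 ≤ N := by linarith
  -- All parameters are bounded by small powers of `N`.
  have hnk : (n : ℝ) * k ≤ N ^ 2 := by
    have h1 : (n : ℝ) * k ≤ 2 * N := by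
      rw [hNdef]
      nlinarith [mul_nonneg (by linarith : (0 : ℝ) ≤ n) (by linarith : (0 : ℝ) ≤ k)]
    nlinarith
  have hnk1 : 1 ≤ (n : ℝ) * k := by nlinarith
  have hφN : φ ≤ N := by
    rw [hNdef]; nlinarith
  have hL : 2 * ((n : ℝ) * k) ≤ N ^ 3 := by nlinarith [sq_nonneg N]
  have hL2 : 2 * (2 * ((n : ℝ) * k)) ≤ N ^ 4 := by nlinarith [pow_pos hN0 3]
  have hq : (n : ℝ) * k ^ 2 ≤ N ^ 4 := by
    have : (n : ℝ) * k ^ 2 ≤ (n * k) ^ 2 := by nlinarith [sq_nonneg (k : ℝ)]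
    nlinarith
  have hn2 : (n : ℝ) ^ 2 ≤ N ^ 4 := by
    have : (n : ℝ) ^ 2 ≤ (n * k) ^ 2 := by
      gcongr; nlinarith
    nlinarith
  set ε : ℝ := 1 / N ^ ((36 + c) * k) with hε
  have hε0 : 0 < ε := by positivity
  set δ : ℝ := 1 / N ^ (c + 3) with hδ
  set ν : PayoffEntry (⊤ : SimpleGraph V) k → Measure ℝ := fun e => μ.map (A e) with hν
  have haem : ∀ e, AEMeasurable (A e) μ := fun e => by
    have := hA.hasPDF e
    exact HasPDF.aemeasurable (A e) μ volume
  have hprob : ∀ e, IsProbabilityMeasure (ν e) := fun e => Measure.isProbabilityMeasure_map (haem e)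
  have hbound : Measure.pi ν (slowEvent V k ε) ≤
      (2 * (Fintype.card V * k) : ℕ) * ENNReal.ofReal δ := by
    refine measure_slowEvent_le ν hA.map_le hε0.le ?_ ?_
    · rw [ENNReal.ofReal_le_one, hδ, div_le_one (by positivity)]
      exact one_le_pow₀ hN1
    · rw [← ENNReal.ofReal_natCast, ← ENNReal.ofReal_pow (by positivity),
        ← ENNReal.ofReal_mul (by linarith), ← ENNReal.ofReal_mul (by positivity)]
      refine ENNReal.ofReal_le_ofReal ?_
      push_cast
      rw [← hn]
      calc ((n : ℝ) * k ^ 2) ^ (4 + 6 * k) * (φ * (2 * (2 * (n * k) * ε)))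
          = ((n : ℝ) * k ^ 2) ^ (4 + 6 * k) * φ * (2 * (2 * (n * k))) * ε := by ring
        _ ≤ (N ^ 4) ^ (4 + 6 * k) * N * N ^ 4 * ε := by gcongr
        _ = N ^ (21 + 24 * k) / N ^ ((36 + c) * k) := by rw [hε]; ring
        _ ≤ 1 / N ^ (c + 3) := by
          rw [div_le_div_iff₀ (by positivity) (by positivity), ← pow_add, one_mul]
          refine pow_le_pow_right₀ hN1 ?_
          nlinarith
  set M : ℕ := ⌈N ^ (4 + (36 + c) * k)⌉₊ + 1 with hM
  have hMge : N ^ (4 + (36 + c) * k) < M := by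
    rw [hM]; push_cast
    linarith [Nat.le_ceil (N ^ (4 + (36 + c) * k))]
  have hMle : (M : ℝ) ≤ N ^ (4 + (36 + c) * k) + 2 := by
    rw [hM]; push_cast
    linarith [Nat.ceil_lt_add_one (show 0 ≤ N ^ (4 + (36 + c) * k) by positivity)]
  have hMε : (n : ℝ) ^ 2 < M * ε := by
    have h1 : (n : ℝ) ^ 2 ≤ N ^ (4 + (36 + c) * k) * ε := by
      rw [hε, pow_add, mul_one_div, mul_div_assoc, div_self (by positivity), mul_one]
      exact hn2
    nlinarith
  have hsteps : ((2 * (n * k) * M : ℕ) : ℝ) ≤ N ^ ((40 + c) * k) := by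
    push_cast
    have hX : 2 ≤ N ^ (4 + (36 + c) * k) :=
      hN.trans (le_self_pow₀ hN1 (by positivity))
    calc 2 * ((n : ℝ) * k) * M ≤ N ^ 3 * (N * N ^ (4 + (36 + c) * k)) := by
          gcongr
          nlinarith
      _ = N ^ (8 + (36 + c) * k) := by ring
      _ ≤ N ^ ((40 + c) * k) := pow_le_pow_right₀ hN1 (by nlinarith)
  have hsupp : μ {ω | ¬ ∀ e, A e ω ∈ Set.Icc (-1 : ℝ) 1} = 0 :=
    ae_iff.1 (ae_all_iff.2 hA.supported)
  calc μ {ω | ¬ ∀ σ : ℕ → V → Fin k, IsBRExecution (fun e => A e ω) σ →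
      ∃ t : ℕ, (t : ℝ) ≤ N ^ ((40 + c) * k) ∧ IsPNE (fun e => A e ω) (σ t)}
      ≤ μ ({ω | ¬ ∀ e, A e ω ∈ Set.Icc (-1 : ℝ) 1} ∪
          (fun ω e => A e ω) ⁻¹' slowEvent V k ε) := by
        refine measure_mono fun ω hω => ?_
        by_contra hcon
        rw [Set.mem_union, not_or] at hcon
        refine hω fun σ hσ => ?_
        obtain ⟨t, ht, hpne⟩ := hσ.exists_isPNE (not_not.1 hcon.1) hcon.2 hMε
        exact ⟨t, le_trans (by exact_mod_cast ht) hsteps, hpne⟩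
    _ ≤ 0 + Measure.pi ν (slowEvent V k ε) := by
        refine (measure_union_le _ _).trans (add_le_add hsupp.le ?_)
        rw [hν, ← (iIndepFun_iff_map_fun_eq_pi_map haem).1 hA.indep]
        exact Measure.le_map_apply (aemeasurable_pi_lambda _ haem) _
    _ ≤ ENNReal.ofReal (1 / N ^ c) := by
        rw [zero_add]
        refine hbound.trans ?_
        rw [← ENNReal.ofReal_natCast, ← ENNReal.ofReal_mul (by positivity)]
        refine ENNReal.ofReal_le_ofReal ?_
        push_cast
        rw [hδ, mul_one_div, div_le_div_iff₀ (by positivity) (by positivity), one_mul, add_comm c,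
          pow_add]
        gcongr

end Dynamics

end NetCoord

theorem mainTheorem1 :
    ∀ c : ℕ, ∃ C : ℕ, ∀ (n k : ℕ) (φ : ℝ), 0 < φ →
      ∀ {Ω : Type*} [MeasurableSpace Ω] (μ : Measure Ω) [IsProbabilityMeasure μ]
        (A : NetCoord.PayoffEntry (⊤ : SimpleGraph (Fin n)) k → Ω → ℝ),
        NetCoord.IsSmoothedInstance (⊤ : SimpleGraph (Fin n)) k φ μ A →
        μ {ω | ¬ ∀ σ : ℕ → Fin n → Fin k, NetCoord.IsBRExecution (fun e => A e ω) σ →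
            ∃ t : ℕ, (t : ℝ) ≤ ((n : ℝ) * k * φ) ^ (C * k) ∧
              NetCoord.IsPNE (fun e => A e ω) (σ t)}
          ≤ ENNReal.ofReal (1 / ((n : ℝ) * k * φ) ^ c) := by
  intro c
  refine ⟨40 + c, fun n k φ hφ Ω _ μ _ A hA => ?_⟩
  -- With at most one player or one strategy, every profile is an equilibrium. This covers
  -- `n * k = 0`, and all cases in which `φ` may be less than `1 / 2`.
  by_cases htriv : Subsingleton (Fin n) ∨ Subsingleton (Fin k)
  · have hempty : {ω | ¬ ∀ σ : ℕ → Fin n → Fin k, NetCoord.IsBRExecution (fun e => A e ω) σ →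
        ∃ t : ℕ, (t : ℝ) ≤ ((n : ℝ) * k * φ) ^ ((40 + c) * k) ∧
          NetCoord.IsPNE (fun e => A e ω) (σ t)} = ∅ := by
      refine Set.eq_empty_of_forall_notMem fun ω hω => hω fun σ _ => ⟨0, ?_, ?_⟩
      · rw [Nat.cast_zero]; positivity
      · rcases htriv with _ | _
        · exact NetCoord.isPNE_of_subsingleton_players _ _
        · exact NetCoord.isPNE_of_subsingleton _ _
    rw [hempty, measure_empty]
    exact zero_le
  · rw [not_or, Fin.subsingleton_iff_le_one, Fin.subsingleton_iff_le_one] at htriv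
    have : NeZero k := ⟨by omega⟩
    have : NeZero n := ⟨by omega⟩
    have hne : (⟨0, by omega⟩ : Fin n) ≠ ⟨1, by omega⟩ := by simp
    have hφ2 := hA.one_le_two_mul (NetCoord.PayoffEntry.mk (G := ⊤) hne 0 0)
    have hN : (2 : ℝ) ≤ (Fintype.card (Fin n) : ℝ) * k * φ := by
      have h1 : (2 : ℝ) ≤ n := by exact_mod_cast (by omega : 2 ≤ n)
      have h2 : (2 : ℝ) ≤ k := by exact_mod_cast (by omega : 2 ≤ k)
      rw [Fintype.card_fin]
      nlinarith [mul_le_mul h1 h2 (by norm_num) (by linarith)]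
    simpa only [Fintype.card_fin] using
      NetCoord.measure_exists_slow_execution_le (c := c) hN hφ2 (by omega) μ A hA
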